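/- **Setting.** Let $\Omega$ be a non-empty set and $\mathcal{E}\subseteq\wp(\Omega)$ a non-empty family of events; an assessment (called belief, probability or necessity assessment according to the notion applied to it) is any function $b:\mathcal{E}\to[0,1]$. For non-empty $B\subseteq\Omega$ and $E\subseteq\Omega$ put $\iota_B(E)=\min_{\omega\in B}\mathbf{1}_E(\omega)$, i.e. $1$ if $B\subseteq E$ and $0$ otherwise. For a finite non-empty $\mathcal{F}=\{E_1,\dots,E_n\}\subseteq\mathcal{E}$ let $\mathcal{A}_\mathcal{F}$ be the (finite) algebra of subsets of $\Omega$ generated by $\mathcal{F}$, $\mathcal{U}_\mathcal{F}=\mathcal{A}_\mathcal{F}\setminus\{\emptyset\}$, $\mathcal{C}_\mathcal{F}$ the set of atoms of $\mathcal{A}_\mathcal{F}$, and let $\mathbf{chains}(\mathcal{U}_\mathcal{F})$ be the collection of all families $\{D_1,\dots,D_m\}$ with $D_k=C_{i_1}\cup\dots\cup C_{i_k}$, where $C_{i_1},\dots,C_{i_m}$ is an enumeration without repetitions of $\mathcal{C}_\mathcal{F}$. A function $s:\{0,1\}\times[0,1]\to[0,+\infty]$ is a *(strictly) proper scoring rule*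 if for every $p\in[0,1]$ the expression $p\,s(1,x)+(1-p)\,s(0,x)$ (with $0\cdot\infty=0$) is uniquely minimized over $x\in[0,1]$ at $x=p$, and $s(i,\cdot)$ is continuous for $i\in\{0,1\}$. For a family $\mathcal{D}\subseteq\mathcal{U}_\mathcal{F}$ consider the two conditions * $\mathrm{S}(\mathcal{F},\mathcal{D})$: there are real numbers $x_B\ge 0$ $(B\in\mathcal{D})$ with $\sum_{B\in\mathcal{D}}x_B=1$ and $\sum_{B\in\mathcal{D}}\iota_B(E_i)\,x_B=b(E_i)$ for $i=1,\dots,n$; * $\mathrm{L}_s(\mathcal{F},\mathcal{D})$: there is no $b^*:\mathcal{F}\to[0,1]$ distinct from $b|_\mathcal{F}$ such that $\sum_{i=1}^n s(\iota_B(E_i),b^*(E_i))<\sum_{i=1}^n s(\iota_B(E_i),b(E_i))$ for every $B\in\mathcal{D}$. The assessment $b$ is * *coherent-3* (resp. *coherent-5($s$)*) if for every finite non-empty $\mathcal{F}\subseteq\mathcal{E}$ condition $\mathrm{S}(\mathcal{F},\mathcal{U}_\mathcal{F})$ (resp. $\mathrm{L}_s(\mathcal{F},\mathcal{U}_\mathcal{F})$)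 holds; * *coherent-3P* (resp. *coherent-5P($s$)*) if for every finite non-empty $\mathcal{F}\subseteq\mathcal{E}$ condition $\mathrm{S}(\mathcal{F},\mathcal{C}_\mathcal{F})$ (resp. $\mathrm{L}_s(\mathcal{F},\mathcal{C}_\mathcal{F})$) holds; * *coherent-3N* (resp. *coherent-5N($s$)*) if for every finite non-empty $\mathcal{F}\subseteq\mathcal{E}$ there is $\mathcal{D}_\mathcal{F}\in\mathbf{chains}(\mathcal{U}_\mathcal{F})$ such that $\mathrm{S}(\mathcal{F},\mathcal{D}_\mathcal{F})$ (resp. $\mathrm{L}_s(\mathcal{F},\mathcal{D}_\mathcal{F})$) holds. **Theorem.** Let $s$ be a fixed proper scoring rule. Then: 1. a belief assessment $Bel:\mathcal{E}\to[0,1]$ is coherent-3 if and only if it is coherent-5($s$); 2. a probability assessment $P:\mathcal{E}\to[0,1]$ is coherent-3P if and only if it is coherent-5P($s$); 3. a necessity assessment $N:\mathcal{E}\to[0,1]$ is coherent-3N if and only if it is coherent-5N($s$). -/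

import Mathlib

open scoped ENNReal unitInterval

namespace DempsterShafer

noncomputable section

variable {Ω : Type*}

/-- The pessimistic generalized indicator `min_{ω ∈ B} 1_E(ω) ∈ {0, 1}` of the event `E` at the
nonempty event `B`: it is `1` if `B ⊆ E` and `0` otherwise. -/
def genInd (B E : Set Ω) : Fin 2 :=
  open Classical in if B ⊆ E then 1 else 0

/-- For nonempty `B`, `genInd B E` is indeed the minimum over `B` of the indicator of `E`. -/
theorem genInd_isLeast {B E : Set Ω} (hB : B.Nonempty) :
    IsLeast ((fun ω => E.indicator (1 : Ω → Fin 2) ω) '' B) (genInd B E) := by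
  classical
  unfold genInd
  split_ifs with h
  · refine ⟨?_, ?_⟩
    · obtain ⟨ω, hω⟩ := hB
      exact ⟨ω, hω, by simp [h hω]⟩
    · rintro _ ⟨ω, hω, rfl⟩
      simp [h hω]
  · refine ⟨?_, fun _ _ => Fin.zero_le _⟩
    obtain ⟨ω, hω, hωE⟩ := Set.not_subset.1 h
    exact ⟨ω, hω, by simp [hωE]⟩

/-- The algebra generated by a finite family of events is finite. -/
theorem finite_algebra (F : Finset (Set Ω)) :
    (MeasureTheory.generateSetAlgebra (F : Set (Set Ω))).Finite := by
  classical
  let f : Ω → (F → Prop) := fun ω E => ω ∈ (E : Set Ω)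
  refine (Set.finite_range (fun S : Set (F → Prop) => f ⁻¹' S)).subset ?_
  intro A hA
  induction hA with
  | base A hA => exact ⟨{g | g ⟨A, hA⟩}, rfl⟩
  | empty => exact ⟨∅, rfl⟩
  | compl A _ ih =>
    obtain ⟨S, rfl⟩ := ih
    exact ⟨Sᶜ, rfl⟩
  | union A B _ _ ihA ihB =>
    obtain ⟨S, rfl⟩ := ihA
    obtain ⟨T, rfl⟩ := ihB
    exact ⟨S ∪ T, rfl⟩

/-- The finite algebra `algebra(F)` generated by a finite family `F` of events. -/
def algebra (F : Finset (Set Ω)) : Finset (Set Ω) := (finite_algebra F).toFinset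

/-- `𝒰_F = algebra(F) \ {∅}`. -/
def nonemptyEvents (F : Finset (Set Ω)) : Finset (Set Ω) :=
  open Classical in (algebra F).filter (fun B => B.Nonempty)

/-- `𝒞_F`: the atoms of `algebra(F)`, i.e. its minimal nonempty elements. -/
def atoms (F : Finset (Set Ω)) : Finset (Set Ω) :=
  open Classical in (nonemptyEvents F).filter (fun C => ∀ A ∈ nonemptyEvents F, A ⊆ C → A = C)

/-- `chains(𝒰_F)`: the families `{D₁, …, D_m}` with `D_k = C_{i₁} ∪ ⋯ ∪ C_{i_k}` for some
enumeration `C_{i₁}, …, C_{i_m}` of the atoms of `algebra(F)`. -/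
def chains (F : Finset (Set Ω)) : Set (Finset (Set Ω)) :=
  {𝓓 | ∃ (m : ℕ) (c : Fin m ≃ atoms F),
    (𝓓 : Set (Set Ω)) = Set.range (fun k : Fin m => ⋃ j ∈ Set.Iic k, (c j : Set Ω))}

/-- The linear system with unknowns `x_B ≥ 0`, `B ∈ 𝓓`, `∑ x_B = 1`, and
`∑_B (min_{ω ∈ B} 1_E(ω)) x_B = d(E)` for all `E ∈ F`, is compatible. -/
def Compatible (𝓓 F : Finset (Set Ω)) (d : F → I) : Prop :=
  ∃ x : Set Ω → ℝ,
    (∀ E : F, ∑ B ∈ 𝓓, (((genInd B (E : Set Ω) : Fin 2) : ℕ) : ℝ) * x B = (d E : ℝ)) ∧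
    ∑ B ∈ 𝓓, x B = 1 ∧
    ∀ B ∈ 𝓓, 0 ≤ x B

/-- A (strictly) proper scoring rule `s : {0,1} × [0,1] → [0,+∞]`: for every `p ∈ [0,1]` the
map `x ↦ p s(1,x) + (1-p) s(0,x)` has its unique minimum at `x = p` (with `0 · ∞ = 0`), and
`s(i, ·)` is continuous as a map into `[0,+∞]`. -/
structure IsProperScoringRule (s : Fin 2 → I → ℝ≥0∞) : Prop where
  uniquely_minimized : ∀ p x : I, x ≠ p →
    ENNReal.ofReal (p : ℝ) * s 1 p + ENNReal.ofReal (1 - (p : ℝ)) * s 0 p <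
      ENNReal.ofReal (p : ℝ) * s 1 x + ENNReal.ofReal (1 - (p : ℝ)) * s 0 x
  continuous : ∀ i : Fin 2, Continuous (s i)

/-- The total penalty `L_F(B) = ∑_{E ∈ F} s(min_{ω ∈ B} 1_E(ω), d(E))`. -/
def penalty (s : Fin 2 → I → ℝ≥0∞) (F : Finset (Set Ω)) (d : F → I) (B : Set Ω) : ℝ≥0∞ :=
  ∑ E : F, s (genInd B (E : Set Ω)) (d E)

/-- There is a distinct assessment on `F` whose total penalty is strictly smaller than that of `d`
at every element of `𝓓`. -/
def Dominated (s : Fin 2 → I → ℝ≥0∞) (𝓓 F : Finset (Set Ω)) (d : F → I) : Prop :=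
  ∃ d' : F → I, d' ≠ d ∧ ∀ B ∈ 𝓓, penalty s F d' B < penalty s F d B

/-- The restriction of an assessment on `𝓔` to a finite subfamily `F`. -/
def restrictTo {𝓔 : Set (Set Ω)} (b : 𝓔 → I) (F : Finset (Set Ω)) (hF : (F : Set (Set Ω)) ⊆ 𝓔) :
    F → I :=
  fun E => b ⟨E, hF E.2⟩

/-- Coherence-3 of a belief assessment. -/
def Coherent3 {𝓔 : Set (Set Ω)} (Bel : 𝓔 → I) : Prop :=
  ∀ (F : Finset (Set Ω)) (hF : (F : Set (Set Ω)) ⊆ 𝓔), F.Nonempty →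
    Compatible (nonemptyEvents F) F (restrictTo Bel F hF)

/-- Coherence-5(`s`) of a belief assessment. -/
def Coherent5 (s : Fin 2 → I → ℝ≥0∞) {𝓔 : Set (Set Ω)} (Bel : 𝓔 → I) : Prop :=
  ∀ (F : Finset (Set Ω)) (hF : (F : Set (Set Ω)) ⊆ 𝓔), F.Nonempty →
    ¬ Dominated s (nonemptyEvents F) F (restrictTo Bel F hF)

/-- Coherence-3P of a probability assessment. -/
def Coherent3P {𝓔 : Set (Set Ω)} (P : 𝓔 → I) : Prop :=
  ∀ (F : Finset (Set Ω)) (hF : (F : Set (Set Ω)) ⊆ 𝓔), F.Nonempty →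
    Compatible (atoms F) F (restrictTo P F hF)

/-- Coherence-5P(`s`) of a probability assessment. -/
def Coherent5P (s : Fin 2 → I → ℝ≥0∞) {𝓔 : Set (Set Ω)} (P : 𝓔 → I) : Prop :=
  ∀ (F : Finset (Set Ω)) (hF : (F : Set (Set Ω)) ⊆ 𝓔), F.Nonempty →
    ¬ Dominated s (atoms F) F (restrictTo P F hF)

/-- Coherence-3N of a necessity assessment. -/
def Coherent3N {𝓔 : Set (Set Ω)} (N : 𝓔 → I) : Prop :=
  ∀ (F : Finset (Set Ω)) (hF : (F : Set (Set Ω)) ⊆ 𝓔), F.Nonempty →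
    ∃ 𝓓 ∈ chains F, Compatible 𝓓 F (restrictTo N F hF)

/-- Coherence-5N(`s`) of a necessity assessment. -/
def Coherent5N (s : Fin 2 → I → ℝ≥0∞) {𝓔 : Set (Set Ω)} (N : 𝓔 → I) : Prop :=
  ∀ (F : Finset (Set Ω)) (hF : (F : Set (Set Ω)) ⊆ 𝓔), F.Nonempty →
    ∃ 𝓓 ∈ chains F, ¬ Dominated s 𝓓 F (restrictTo N F hF)

end

end DempsterShafer

/-!
Everything reduces to one equivalence for a fixed finite nonempty `F` and an arbitrary finite
family `𝓓`: the linear system is compatible if and only if no assessment has a smaller penalty at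
all `B ∈ 𝓓` (`compatible_iff_not_dominated`). Identify `B` with the vertex
`v_B = (genInd B E)_{E ∈ F}` of the cube `[0,1]^F`. Compatibility says that the assessment `d` lies
in the convex hull of the `v_B`. Extend the penalty to the expected score
`K(q, x) = ∑_k (q_k s(1, x_k) + (1 - q_k) s(0, x_k))`, which is affine in `q` and is the penalty
of `x` when `q` is a vertex; propriety says that `K(q, ·)` has `q` as its unique minimizer.

If `d` is in the hull and `x` has a smaller penalty than `d` at every vertex, then by affinity
`K(d, x) < K(d, d)`, against propriety.

If `d` is outside the hull, let `V` be the set of vertices at which the penalty of `d` is finite,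
and let `m` minimize the divergence `G(q) = K(q, d) - K(q, q)` over the hull of `V`. It exists
because `q ↦ K(q, q)` is upper semicontinuous, being an infimum of affine functions
`K(·, x)` with `x` interior (`lowerSemicontinuousOn_divergence`). For `v ∈ V` and
`m_t = (1 - t) m + t v`, affinity and `K(m, m) ≤ K(m, m_t)` give
`G(m) ≤ G(m_t) ≤ (1 - t) G(m) + t (K(v, d) - K(v, m_t))`, so `K(v, m_t) + G(m) ≤ K(v, d)`;
letting `t → 0` and using `G(m) > 0`, the point `m` beats `d` at all of `V`
(`exists_lt_of_finite`). No differentiability of the scoring rule is needed. A small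
move of `m` into the interior of the cube keeps these strict inequalities and makes the penalty
finite at the remaining vertices, where that of `d` is infinite.
-/

open Set Filter Topology

namespace DempsterShafer

/-! ### The unit cube -/

variable {κ : Type*} {s : Fin 2 → I → ℝ≥0∞}

/-- The vertex of the unit cube with coordinates `v`. -/
def vertex (v : κ → Fin 2) : κ → ℝ := fun k => ((v k : ℕ) : ℝ)

/-- The unit cube `[0,1]^κ`. -/
def cube (κ : Type*) : Set (κ → ℝ) := {q | ∀ k, q k ∈ Icc (0 : ℝ) 1}

/-- The coordinatewise retraction of `ℝ^κ` onto the unit cube. -/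
noncomputable def toCube (q : κ → ℝ) : κ → I := fun k => projIcc 0 1 zero_le_one (q k)

theorem convex_cube : Convex ℝ (cube κ) := by
  intro q hq r hr a b ha hb hab k
  exact convex_Icc (0 : ℝ) 1 (hq k) (hr k) ha hb hab

theorem vertex_mem_cube (v : κ → Fin 2) : vertex v ∈ cube κ := by
  intro k
  have h : (v k : ℕ) ≤ 1 := by omega
  exact ⟨Nat.cast_nonneg _, by unfold vertex; exact_mod_cast h⟩

theorem toCube_coe {q : κ → ℝ} (hq : q ∈ cube κ) : (fun k => (toCube q k : ℝ)) = q := by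
  funext k
  simp [toCube, projIcc_of_mem zero_le_one (hq k)]

theorem continuous_toCube : Continuous (toCube : (κ → ℝ) → κ → I) :=
  continuous_pi fun k => continuous_projIcc.comp (continuous_apply k)

theorem dense_interior : Dense {x : κ → I | ∀ k, x k ∈ Ioo (0 : I) 1} := by
  have h : Dense (Ioo (0 : I) 1) := by
    rw [dense_iff_closure_eq, closure_Ioo zero_ne_one]
    exact eq_univ_of_forall fun x => ⟨unitInterval.nonneg', unitInterval.le_one'⟩
  have := dense_pi (univ : Set κ) (s := fun _ => Ioo (0 : I) 1) fun _ _ => h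
  convert this using 1
  ext x
  simp [Set.mem_pi]

/-! ### The expected score -/

variable [Fintype κ]

/-- The expected total score `∑_k (q_k s(1, x_k) + (1 - q_k) s(0, x_k))` of the forecast `x` when
the events have probabilities `q`. It is meaningful for `q` in the unit cube; `q` is a real vector
so that convex combinations can be taken. -/
noncomputable def expScore (s : Fin 2 → I → ℝ≥0∞) (q : κ → ℝ) (x : κ → I) : ℝ≥0∞ :=
  ∑ k, (ENNReal.ofReal (q k) * s 1 (x k) + ENNReal.ofReal (1 - q k) * s 0 (x k))

/-- The real counterpart of `expScore`, with infinite scores replaced by `0`: it agrees with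
`expScore` wherever the latter is finite, see `expScore_toReal`. -/
noncomputable def realScore (s : Fin 2 → I → ℝ≥0∞) (q : κ → ℝ) (x : κ → I) : ℝ :=
  ∑ k, (q k * (s 1 (x k)).toReal + (1 - q k) * (s 0 (x k)).toReal)

theorem expScore_vertex (v : κ → Fin 2) (x : κ → I) :
    expScore s (vertex v) x = ∑ k, s (v k) (x k) := by
  unfold expScore vertex
  refine Finset.sum_congr rfl fun k _ => ?_
  generalize v k = i
  fin_cases i <;> simp

theorem expScore_combo {q r : κ → ℝ} (hq : q ∈ cube κ) (hr : r ∈ cube κ) {a b : ℝ}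
    (ha : 0 ≤ a) (hb : 0 ≤ b) (hab : a + b = 1) (x : κ → I) :
    expScore s (a • q + b • r) x =
      ENNReal.ofReal a * expScore s q x + ENNReal.ofReal b * expScore s r x := by
  simp only [expScore, Finset.mul_sum, ← Finset.sum_add_distrib]
  refine Finset.sum_congr rfl fun k _ => ?_
  have h1 : ENNReal.ofReal ((a • q + b • r) k) =
      ENNReal.ofReal a * ENNReal.ofReal (q k) + ENNReal.ofReal b * ENNReal.ofReal (r k) := by
    rw [← ENNReal.ofReal_mul ha, ← ENNReal.ofReal_mul hb,
      ← ENNReal.ofReal_add (mul_nonneg ha (hq k).1) (mul_nonneg hb (hr k).1)]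
    rfl
  have h0 : ENNReal.ofReal (1 - (a • q + b • r) k) =
      ENNReal.ofReal a * ENNReal.ofReal (1 - q k)
        + ENNReal.ofReal b * ENNReal.ofReal (1 - r k) := by
    rw [← ENNReal.ofReal_mul ha, ← ENNReal.ofReal_mul hb,
      ← ENNReal.ofReal_add (mul_nonneg ha (sub_nonneg.2 (hq k).2))
        (mul_nonneg hb (sub_nonneg.2 (hr k).2))]
    congr 1
    simp only [Pi.add_apply, Pi.smul_apply, smul_eq_mul]
    linear_combination -hab
  rw [h1, h0]
  ring

theorem realScore_combo (q r : κ → ℝ) {a b : ℝ} (hab : a + b = 1) (x : κ → I) :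
    realScore s (a • q + b • r) x = a * realScore s q x + b * realScore s r x := by
  simp only [realScore, Finset.mul_sum, ← Finset.sum_add_distrib]
  refine Finset.sum_congr rfl fun k _ => ?_
  simp only [Pi.add_apply, Pi.smul_apply, smul_eq_mul]
  linear_combination (-(s 0 (x k)).toReal) * hab

theorem expScore_toReal {q : κ → ℝ} (hq : q ∈ cube κ) {x : κ → I} (h : expScore s q x ≠ ⊤) :
    (expScore s q x).toReal = realScore s q x := by
  unfold expScore at h ⊢
  have hk := ENNReal.sum_ne_top.1 h
  rw [ENNReal.toReal_sum hk]
  refine Finset.sum_congr rfl fun k hk' => ?_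
  have := ENNReal.add_ne_top.1 (hk k hk')
  rw [ENNReal.toReal_add this.1 this.2, ENNReal.toReal_mul, ENNReal.toReal_mul,
    ENNReal.toReal_ofReal (hq k).1, ENNReal.toReal_ofReal (sub_nonneg.2 (hq k).2)]

theorem continuous_realScore (x : κ → I) : Continuous fun q : κ → ℝ => realScore s q x := by
  unfold realScore
  fun_prop

theorem IsProperScoringRule.continuous_expScore (hs : IsProperScoringRule s) (q : κ → ℝ) :
    Continuous fun x : κ → I => expScore s q x := by
  unfold expScore
  refine continuous_finsetSum _ fun k _ => ?_
  exact ((ENNReal.continuous_const_mul ENNReal.ofReal_ne_top).comp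
      ((hs.continuous 1).comp (continuous_apply k))).add
    ((ENNReal.continuous_const_mul ENNReal.ofReal_ne_top).comp
      ((hs.continuous 0).comp (continuous_apply k)))

/-! ### Consequences of propriety -/

theorem IsProperScoringRule.score_self_ne_top (hs : IsProperScoringRule s) (p : I) :
    ENNReal.ofReal (p : ℝ) * s 1 p + ENNReal.ofReal (1 - (p : ℝ)) * s 0 p ≠ ⊤ := by
  obtain ⟨x, hx⟩ := exists_ne p
  exact (hs.uniquely_minimized p x hx).ne_top

theorem IsProperScoringRule.score_self_le (hs : IsProperScoringRule s) (p x : I) :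
    ENNReal.ofReal (p : ℝ) * s 1 p + ENNReal.ofReal (1 - (p : ℝ)) * s 0 p ≤
      ENNReal.ofReal (p : ℝ) * s 1 x + ENNReal.ofReal (1 - (p : ℝ)) * s 0 x := by
  by_cases h : x = p
  · rw [h]
  · exact (hs.uniquely_minimized p x h).le

theorem IsProperScoringRule.ne_top_of_mem_Ioo (hs : IsProperScoringRule s) {x : I}
    (hx : x ∈ Ioo (0 : I) 1) (i : Fin 2) : s i x ≠ ⊤ := by
  have h := ENNReal.add_ne_top.1 (hs.score_self_ne_top x)
  have h1 : ENNReal.ofReal (x : ℝ) ≠ 0 := (ENNReal.ofReal_pos.2 hx.1).ne'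
  have h0 : ENNReal.ofReal (1 - (x : ℝ)) ≠ 0 := (ENNReal.ofReal_pos.2 (sub_pos.2 hx.2)).ne'
  intro hi
  fin_cases i
  · exact h.2 ((congrArg _ hi).trans (ENNReal.mul_top h0))
  · exact h.1 ((congrArg _ hi).trans (ENNReal.mul_top h1))

theorem IsProperScoringRule.expScore_ne_top_of_interior (hs : IsProperScoringRule s)
    (q : κ → ℝ) {x : κ → I} (hx : ∀ k, x k ∈ Ioo (0 : I) 1) : expScore s q x ≠ ⊤ := by
  refine ENNReal.sum_ne_top.2 fun k _ => ENNReal.add_ne_top.2 ⟨?_, ?_⟩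
  · exact ENNReal.mul_ne_top ENNReal.ofReal_ne_top (hs.ne_top_of_mem_Ioo (hx k) 1)
  · exact ENNReal.mul_ne_top ENNReal.ofReal_ne_top (hs.ne_top_of_mem_Ioo (hx k) 0)

theorem IsProperScoringRule.expScore_self_ne_top (hs : IsProperScoringRule s) (m : κ → I) :
    expScore s (fun k => (m k : ℝ)) m ≠ ⊤ :=
  ENNReal.sum_ne_top.2 fun k _ => hs.score_self_ne_top (m k)

theorem IsProperScoringRule.expScore_self_le (hs : IsProperScoringRule s) (m x : κ → I) :
    expScore s (fun k => (m k : ℝ)) m ≤ expScore s (fun k => (m k : ℝ)) x :=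
  Finset.sum_le_sum fun k _ => hs.score_self_le (m k) (x k)

theorem IsProperScoringRule.expScore_self_lt (hs : IsProperScoringRule s) {m x : κ → I}
    (h : x ≠ m) : expScore s (fun k => (m k : ℝ)) m < expScore s (fun k => (m k : ℝ)) x := by
  classical
  obtain ⟨k, hk⟩ := Function.ne_iff.1 h
  have hfin := ENNReal.sum_ne_top.1 (hs.expScore_self_ne_top m)
  unfold expScore
  rw [← Finset.add_sum_erase _ _ (Finset.mem_univ k),
    ← Finset.add_sum_erase _ _ (Finset.mem_univ k)]
  refine ENNReal.add_lt_add_of_lt_of_le ?_ (hs.uniquely_minimized _ _ hk) ?_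
  · exact ENNReal.sum_ne_top.2 fun j hj => hfin j (Finset.mem_univ j)
  · exact Finset.sum_le_sum fun j _ => hs.score_self_le (m j) (x j)

theorem IsProperScoringRule.realScore_self_le (hs : IsProperScoringRule s) {q : κ → ℝ}
    (hq : q ∈ cube κ) {x : κ → I} (hx : expScore s q x ≠ ⊤) :
    realScore s q (toCube q) ≤ realScore s q x := by
  have hle := hs.expScore_self_le (toCube q) x
  have hfin := hs.expScore_self_ne_top (toCube q)
  rw [toCube_coe hq] at hle hfin
  rw [← expScore_toReal hq hfin, ← expScore_toReal hq hx]
  exact ENNReal.toReal_mono hx hle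

/-! ### Convex hulls of vertices -/

theorem convex_setOf_expScore_lt_top (x : κ → I) :
    Convex ℝ {q | q ∈ cube κ ∧ expScore s q x ≠ ⊤} := by
  rintro q ⟨hq, hq'⟩ r ⟨hr, hr'⟩ a b ha hb hab
  refine ⟨convex_cube hq hr ha hb hab, ?_⟩
  rw [expScore_combo hq hr ha hb hab]
  exact ENNReal.add_ne_top.2
    ⟨ENNReal.mul_ne_top ENNReal.ofReal_ne_top hq', ENNReal.mul_ne_top ENNReal.ofReal_ne_top hr'⟩

theorem convex_setOf_expScore_lt (x y : κ → I) :
    Convex ℝ {q | q ∈ cube κ ∧ expScore s q x < expScore s q y} := by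
  rw [convex_iff_forall_pos]
  rintro q ⟨hq, hq'⟩ r ⟨hr, hr'⟩ a b ha hb hab
  refine ⟨convex_cube hq hr ha.le hb.le hab, ?_⟩
  rw [expScore_combo hq hr ha.le hb.le hab, expScore_combo hq hr ha.le hb.le hab]
  exact ENNReal.add_lt_add
    ((ENNReal.mul_lt_mul_iff_right (ENNReal.ofReal_pos.2 ha).ne' ENNReal.ofReal_ne_top).2 hq')
    ((ENNReal.mul_lt_mul_iff_right (ENNReal.ofReal_pos.2 hb).ne' ENNReal.ofReal_ne_top).2 hr')

/-- The divergence `q ↦ K(q, d) - K(q, q)` from `d` is lower semicontinuous. -/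
theorem IsProperScoringRule.lowerSemicontinuousOn_divergence (hs : IsProperScoringRule s)
    (d : κ → I) {C : Set (κ → ℝ)} (hC : C ⊆ cube κ) :
    LowerSemicontinuousOn (fun q => realScore s q d - realScore s q (toCube q)) C := by
  intro q hq y hy
  have hqc := hC hq
  have hfin : expScore s q (toCube q) ≠ ⊤ := by
    have := hs.expScore_self_ne_top (toCube q)
    rwa [toCube_coe hqc] at this
  -- Near `toCube q` there is an interior `x` with `K(q, x) < K(q, d) - y`; for that `x` the
  -- function `K(·, d) - K(·, x)` is continuous and a lower bound for the divergence.
  have hlt : expScore s q (toCube q) < ENNReal.ofReal (realScore s q d - y) := by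
    rw [ENNReal.lt_ofReal_iff_toReal_lt hfin, expScore_toReal hqc hfin]
    linarith
  obtain ⟨x, hx, hxI⟩ := dense_interior.exists_mem_open
    (isOpen_Iio.preimage (hs.continuous_expScore q)) ⟨_, hlt⟩
  have hxtop := fun r : κ → ℝ => hs.expScore_ne_top_of_interior r hx
  have hxI' : expScore s q x < ENNReal.ofReal (realScore s q d - y) := hxI
  rw [ENNReal.lt_ofReal_iff_toReal_lt (hxtop q), expScore_toReal hqc (hxtop q)] at hxI'
  have hcont : Continuous fun r => realScore s r d - realScore s r x :=
    (continuous_realScore d).sub (continuous_realScore x)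
  have hev : ∀ᶠ r in 𝓝[C] q, y < realScore s r d - realScore s r x :=
    (hcont.continuousAt.continuousWithinAt).eventually_const_lt (by linarith)
  filter_upwards [hev, self_mem_nhdsWithin] with r hr hrC
  have := hs.realScore_self_le (hC hrC) (hxtop r)
  linarith

/-- If `m` minimizes the divergence from `d` over a convex set on which the score of `d` is
finite, then `m` improves on `d` at each point of the set by at least the minimal divergence. -/
theorem IsProperScoringRule.expScore_add_le_of_isMinOn (hs : IsProperScoringRule s)
    {d : κ → I} {C : Set (κ → ℝ)} (hC : C ⊆ cube κ) (hconv : Convex ℝ C)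
    (hd : ∀ q ∈ C, expScore s q d ≠ ⊤) {m v : κ → ℝ} (hm : m ∈ C) (hv : v ∈ C)
    (hmin : IsMinOn (fun q => realScore s q d - realScore s q (toCube q)) C m)
    (hpos : 0 ≤ realScore s m d - realScore s m (toCube m)) :
    expScore s v (toCube m) + ENNReal.ofReal (realScore s m d - realScore s m (toCube m)) ≤
      expScore s v d := by
  set G := realScore s m d - realScore s m (toCube m) with hG
  have hclosed : IsClosed {t : ℝ | expScore s v (toCube ((1 - t) • m + t • v))
      + ENNReal.ofReal G ≤ expScore s v d} := by
    refine isClosed_le (Continuous.add ?_ continuous_const) continuous_const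
    refine (hs.continuous_expScore v).comp (continuous_toCube.comp ?_)
    fun_prop
  have hsub : Ioo (0 : ℝ) 1 ⊆ {t : ℝ | expScore s v (toCube ((1 - t) • m + t • v))
      + ENNReal.ofReal G ≤ expScore s v d} := by
    rintro t ⟨ht0, ht1⟩
    have ht1' : 0 < 1 - t := sub_pos.2 ht1
    have hab : (1 - t) + t = 1 := sub_add_cancel 1 t
    set r := (1 - t) • m + t • v with hr
    have hrC : r ∈ C := hconv hm hv ht1'.le ht0.le hab
    have hrfin : expScore s r (toCube r) ≠ ⊤ := by
      have := hs.expScore_self_ne_top (toCube r)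
      rwa [toCube_coe (hC hrC)] at this
    -- `K(r, r)` is a combination of `K(m, r)` and `K(v, r)` with positive weights, so these
    -- two are finite as well.
    have hsplit : expScore s r (toCube r) = ENNReal.ofReal (1 - t) * expScore s m (toCube r)
        + ENNReal.ofReal t * expScore s v (toCube r) :=
      expScore_combo (hC hm) (hC hv) ht1'.le ht0.le hab _
    rw [hsplit, ENNReal.add_ne_top] at hrfin
    have hmfin : expScore s m (toCube r) ≠ ⊤ := fun h => hrfin.1 (by
      rw [h, ENNReal.mul_top (ENNReal.ofReal_pos.2 ht1').ne'])
    have hvfin : expScore s v (toCube r) ≠ ⊤ := fun h => hrfin.2 (by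
      rw [h, ENNReal.mul_top (ENNReal.ofReal_pos.2 ht0).ne'])
    have h1 : G ≤ realScore s r d - realScore s r (toCube r) := hmin hrC
    have h2 : realScore s r d = (1 - t) * realScore s m d + t * realScore s v d :=
      realScore_combo m v hab d
    have h3 : realScore s r (toCube r) =
        (1 - t) * realScore s m (toCube r) + t * realScore s v (toCube r) :=
      realScore_combo m v hab _
    have h4 := mul_le_mul_of_nonneg_left (hs.realScore_self_le (hC hm) hmfin) ht1'.le
    have h5 : t * (realScore s v (toCube r) + G) ≤ t * realScore s v d := by
      rw [h2, h3] at h1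
      rw [hG] at h1 ⊢
      nlinarith
    have h6 := le_of_mul_le_mul_left h5 ht0
    change expScore s v (toCube r) + ENNReal.ofReal G ≤ expScore s v d
    rw [← ENNReal.ofReal_toReal hvfin, ← ENNReal.ofReal_toReal (hd v hv),
      ← ENNReal.ofReal_add ENNReal.toReal_nonneg hpos, expScore_toReal (hC hv) hvfin,
      expScore_toReal (hC hv) (hd v hv)]
    exact ENNReal.ofReal_le_ofReal h6
  have h0 : (0 : ℝ) ∈ closure (Ioo (0 : ℝ) 1) := by
    rw [closure_Ioo zero_ne_one]
    exact ⟨le_rfl, zero_le_one⟩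
  simpa using hclosed.closure_subset_iff.2 hsub h0

/-- If the score of `d` is finite on a set `V` of vertices whose convex hull misses `d`, some
forecast is strictly better than `d` at every point of `V`. -/
theorem IsProperScoringRule.exists_lt_of_finite (hs : IsProperScoringRule s) {d : κ → I}
    {V : Set (κ → ℝ)} (hfinite : V.Finite) (hV : V ⊆ cube κ)
    (hd : ∀ v ∈ V, expScore s v d ≠ ⊤) (hhull : (fun k => (d k : ℝ)) ∉ convexHull ℝ V) :
    ∃ x : κ → I, ∀ v ∈ V, expScore s v x < expScore s v d := by
  rcases V.eq_empty_or_nonempty with rfl | hne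
  · exact ⟨d, by simp⟩
  have hsub : convexHull ℝ V ⊆ {q | q ∈ cube κ ∧ expScore s q d ≠ ⊤} :=
    convexHull_min (fun v hv => ⟨hV hv, hd v hv⟩) (convex_setOf_expScore_lt_top d)
  have hC : convexHull ℝ V ⊆ cube κ := fun q hq => (hsub hq).1
  have hfin : ∀ q ∈ convexHull ℝ V, expScore s q d ≠ ⊤ := fun q hq => (hsub hq).2
  obtain ⟨m, hm, hmin⟩ := LowerSemicontinuousOn.exists_isMinOn hne.convexHull
    (hfinite.isCompact_convexHull ℝ) (hs.lowerSemicontinuousOn_divergence d hC)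
  have hpos : 0 < realScore s m d - realScore s m (toCube m) := by
    have hdm : d ≠ toCube m := by
      rintro h
      apply hhull
      rwa [h, toCube_coe (hC hm)]
    have hlt := hs.expScore_self_lt hdm
    rw [toCube_coe (hC hm)] at hlt
    have := (ENNReal.toReal_lt_toReal hlt.ne_top (hfin m hm)).2 hlt
    rw [expScore_toReal (hC hm) hlt.ne_top, expScore_toReal (hC hm) (hfin m hm)] at this
    linarith
  refine ⟨toCube m, fun v hv => ?_⟩
  have hv' := subset_convexHull ℝ V hv
  have hle := hs.expScore_add_le_of_isMinOn hC (convex_convexHull ℝ V) hfin hm hv' hmin hpos.le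
  have htop : expScore s v (toCube m) ≠ ⊤ :=
    ne_top_of_le_ne_top (hfin v hv') (le_self_add.trans hle)
  exact (ENNReal.lt_add_right htop (ENNReal.ofReal_pos.2 hpos).ne').trans_le hle

/-- A point of the cube outside the convex hull of finitely many points is strictly improved
upon at all of them by a single forecast, also where its own score is infinite. -/
theorem IsProperScoringRule.exists_lt_of_notMem_convexHull (hs : IsProperScoringRule s)
    {d : κ → I} {V : Set (κ → ℝ)} (hfinite : V.Finite) (hV : V ⊆ cube κ)
    (hhull : (fun k => (d k : ℝ)) ∉ convexHull ℝ V) :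
    ∃ x : κ → I, ∀ v ∈ V, expScore s v x < expScore s v d := by
  set W := {v ∈ V | expScore s v d ≠ ⊤} with hW
  have hWV : W ⊆ V := sep_subset _ _
  obtain ⟨x, hx⟩ := hs.exists_lt_of_finite (hfinite.subset hWV) (hWV.trans hV)
    (fun v hv => hv.2) (fun h => hhull (convexHull_mono hWV h))
  have hopen : IsOpen {y : κ → I | ∀ v ∈ W, expScore s v y < expScore s v d} := by
    simp only [ofPred_forall]
    exact (hfinite.subset hWV).isOpen_biInter fun v _ =>
      isOpen_Iio.preimage (hs.continuous_expScore v)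
  obtain ⟨y, hyI, hy⟩ := dense_interior.exists_mem_open hopen ⟨x, hx⟩
  refine ⟨y, fun v hv => ?_⟩
  by_cases h : expScore s v d = ⊤
  · rw [h]
    exact (hs.expScore_ne_top_of_interior v hyI).lt_top
  · exact hy v ⟨hv, h⟩

/-! ### Compatibility and dominance -/

variable {Ω : Type*}

/-- The vertex of `[0,1]^F` recording at which events of `F` the pessimistic indicator at `B`
equals `1`. -/
noncomputable def eventVertex (F : Finset (Set Ω)) (B : Set Ω) : F → ℝ :=
  vertex fun E : F => genInd B (E : Set Ω)

theorem expScore_eventVertex (F : Finset (Set Ω)) (d : F → I) (B : Set Ω) :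
    expScore s (eventVertex F B) d = penalty s F d B :=
  expScore_vertex _ _

theorem compatible_iff_mem_convexHull (𝓓 F : Finset (Set Ω)) (d : F → I) :
    Compatible 𝓓 F d ↔
      (fun E => (d E : ℝ)) ∈ convexHull ℝ (eventVertex F '' (𝓓 : Set (Set Ω))) := by
  constructor
  · rintro ⟨x, hx, hx1, hx0⟩
    have h : (fun E => (d E : ℝ)) = ∑ B ∈ 𝓓, x B • eventVertex F B := by
      funext E
      rw [← hx E, Finset.sum_apply]
      exact Finset.sum_congr rfl fun B _ => mul_comm _ _
    rw [h]
    exact (convex_convexHull ℝ _).sum_mem hx0 hx1 fun B hB =>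
      subset_convexHull ℝ _ (mem_image_of_mem _ hB)
  · intro h
    have hsub : convexHull ℝ (eventVertex F '' (𝓓 : Set (Set Ω))) ⊆
        {q | ∃ x : Set Ω → ℝ, (∀ E, ∑ B ∈ 𝓓, eventVertex F B E * x B = q E) ∧
          ∑ B ∈ 𝓓, x B = 1 ∧ ∀ B ∈ 𝓓, 0 ≤ x B} := by
      refine convexHull_min ?_ ?_
      · classical
        rintro _ ⟨B, hB, rfl⟩
        have hB' : B ∈ 𝓓 := hB
        refine ⟨Pi.single B 1, fun E => ?_, ?_, fun A _ => ?_⟩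
        · simp [Pi.single_apply, hB']
        · simp [Pi.single_apply, hB']
        · rw [Pi.single_apply]
          split_ifs <;> norm_num
      · rintro q ⟨x, hx, hx1, hx0⟩ r ⟨y, hy, hy1, hy0⟩ a b ha hb hab
        refine ⟨a • x + b • y, fun E => ?_, ?_, fun B hB => ?_⟩
        · simp only [Pi.add_apply, Pi.smul_apply, smul_eq_mul, ← hx E, ← hy E, Finset.mul_sum,
            ← Finset.sum_add_distrib]
          exact Finset.sum_congr rfl fun B _ => by ring
        · simp only [Pi.add_apply, Pi.smul_apply, smul_eq_mul, Finset.sum_add_distrib,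
            ← Finset.mul_sum, hx1, hy1, mul_one, hab]
        · exact add_nonneg (mul_nonneg ha (hx0 B hB)) (mul_nonneg hb (hy0 B hB))
    exact hsub h

theorem IsProperScoringRule.compatible_iff_not_dominated (hs : IsProperScoringRule s)
    (𝓓 : Finset (Set Ω)) {F : Finset (Set Ω)} (hF : F.Nonempty) (d : F → I) :
    Compatible 𝓓 F d ↔ ¬ Dominated s 𝓓 F d := by
  have hcube : eventVertex F '' (𝓓 : Set (Set Ω)) ⊆ cube F := by
    rintro _ ⟨B, _, rfl⟩
    exact vertex_mem_cube _
  rw [compatible_iff_mem_convexHull]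
  constructor
  · rintro hd ⟨d', -, hlt⟩
    have hsub : convexHull ℝ (eventVertex F '' (𝓓 : Set (Set Ω))) ⊆
        {q | q ∈ cube F ∧ expScore s q d' < expScore s q d} := by
      refine convexHull_min ?_ (convex_setOf_expScore_lt d' d)
      rintro _ ⟨B, hB, rfl⟩
      refine ⟨hcube (mem_image_of_mem _ hB), ?_⟩
      rw [expScore_eventVertex, expScore_eventVertex]
      exact hlt B hB
    exact (hs.expScore_self_le d d').not_gt (hsub hd).2
  · intro hnd
    by_contra hhull
    apply hnd
    rcases 𝓓.eq_empty_or_nonempty with rfl | ⟨B, hB⟩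
    · -- With no vertices every assessment dominates, so only a distinct one has to be found.
      have : Nonempty F := hF.to_subtype
      obtain ⟨d', hd'⟩ := exists_ne d
      exact ⟨d', hd', by simp⟩
    · obtain ⟨x, hx⟩ := hs.exists_lt_of_notMem_convexHull
        (𝓓.finite_toSet.image _) hcube hhull
      have hlt : ∀ B ∈ 𝓓, penalty s F x B < penalty s F d B := fun B hB => by
        have := hx _ (mem_image_of_mem _ (Finset.mem_coe.2 hB))
        rwa [expScore_eventVertex, expScore_eventVertex] at this
      exact ⟨x, fun h => (hlt B hB).ne (by rw [h]), hlt⟩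

end DempsterShafer

theorem theorem2 {Ω : Type*} [Nonempty Ω] (𝓔 : Set (Set Ω)) (h𝓔 : 𝓔.Nonempty)
    (s : Fin 2 → I → ℝ≥0∞) (hs : DempsterShafer.IsProperScoringRule s) :
    (∀ Bel : 𝓔 → I, DempsterShafer.Coherent3 Bel ↔ DempsterShafer.Coherent5 s Bel) ∧
    (∀ P : 𝓔 → I, DempsterShafer.Coherent3P P ↔ DempsterShafer.Coherent5P s P) ∧
    (∀ N : 𝓔 → I, DempsterShafer.Coherent3N N ↔ DempsterShafer.Coherent5N s N) := by
  refine ⟨fun Bel => ?_, fun P => ?_, fun N => ?_⟩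
  · exact forall_congr' fun F => forall_congr' fun hF => forall_congr' fun hne =>
      hs.compatible_iff_not_dominated _ hne _
  · exact forall_congr' fun F => forall_congr' fun hF => forall_congr' fun hne =>
      hs.compatible_iff_not_dominated _ hne _
  · exact forall_congr' fun F => forall_congr' fun hF => forall_congr' fun hne =>
      exists_congr fun 𝓓 => and_congr_right fun _ =>
        hs.compatible_iff_not_dominated 𝓓 hne _
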